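/- Let $\mathbb F$ be a field of characteristic zero and let $\mathcal V$ be a multiplicative Poisson vertex algebra: a unital commutative associative $\mathbb F$-algebra with an automorphism $S$ and a bilinear $\lambda$-bracket $\{\cdot\,_\lambda\,\cdot\}:\mathcal V\times\mathcal V\to\mathcal V[\lambda,\lambda^{-1}]$ such that, for all $a,b,c\in\mathcal V$, (i) $\{Sa_\lambda b\}=\lambda^{-1}\{a_\lambda b\}$ and $\{a_\lambda Sb\}=\lambda S\{a_\lambda b\}$; (ii) $\{a_\lambda b\}=-\{b_{\lambda^{-1}S^{-1}}a\}$, with $S^{-1}$ moved to the left; (iii) $\{a_\lambda\{b_\mu c\}\}-\{b_\mu\{a_\lambda c\}\}=\{\{a_\lambda b\}_{\lambda\mu}c\}$; (iv) $\{a_\lambda bc\}=\{a_\lambda b\}c+\{a_\lambda c\}b$ and $\{ab_\lambda c\}=\{a_{\lambda x}c\}(|_{x=S}b)+\{b_{\lambda x}c\}(|_{x=S}a)$, where $(\sum_k p_k(\lambda x)^k)(|_{x=S}b)=\sum_k p_k S^k(b)\lambda^k$. Let $\int:\mathcal V\to\mathcal V/(S-1)\mathcal V$ be the quotient map and set $\{\int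 a,\int b\}=\int\{a_\lambda b\}|_{\lambda=1}$ and $\{\int a,b\}=\{a_\lambda b\}|_{\lambda=1}$ (both are well defined). The Hamiltonian equation of $\int h$ is $\frac{du}{dt}=\{\int h,u\}$, $u\in\mathcal V$; $\int g$ is an integral of motion of it if $\{\int h,\int g\}=0$; two Hamiltonian equations are compatible if their derivations $\{\int h,\cdot\}$ of $\mathcal V$ commute. Let $L(S)=\sum_i u_iS^i$ be a pseudodifference operator, i.e. an element of $\mathcal V((S))$ or of $\mathcal V((S^{-1}))$, with product determined by $S\circ f=S(f)S$. Write $L(z)=\sum_i u_iz^i$ for its symbol, $L^*(\lambda/z)=\sum_i S^{-i}(u_i)(\lambda/z)^{-i}$ for the symbol of its formal adjoint at $\lambda/z$, $\delta_+(x)=\sum_{n\ge0}x^n$, and $\{L(z)_\lambda L(w)\}=\sum_{i,j}\{{u_i}_\lambda u_j\}z^iw^j$. Assume that $L$ satisfies the multiplicative $3$-Adler identity $$\{L(z)_\lambda L(w)\}=L(w\lambda S)L(z)\,\delta_+\Big(\frac{w\lambda S}{z}\Big)\Big(L^*\Big(\frac{\lambda}{z}\Big)-\frac{w\lambda S}{z}L(w)\Big)-\Big(L(z)-L(w\lambda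 S)\frac{w\lambda S}{z}\Big)\delta_+\Big(\frac{w\lambda S}{z}\Big)L(w)L^*\Big(\frac{\lambda}{z}\Big),$$ where each $S$ acts on the coefficients of everything to its right. Let $h_0=0$ and $h_n=-\frac1n\operatorname{mres}L^n$ for $n\ge1$, where $\operatorname{mres}$ is the coefficient of $S^0$. Then: (a) $\{\int h_m,\int h_n\}=0$ for all $m,n\ge0$. (b) The Hamiltonian equations $\frac{du}{dt_n}=\{\int h_n,u\}$, $n\ge0$, are pairwise compatible; for every $n\ge1$ they give, applied to the coefficients of $L$, $$\frac{dL}{dt_n}=\{\textstyle\int h_n,L\}=[(L^{n+1})_+,L],$$ where $(\cdot)_+$ is the part with nonnegative powers of $S$ (for $n=0$ the flow is trivial, since $h_0=0$); and every $\int h_m$, $m\ge0$, is an integral of motion of all these equations. -/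

import Mathlib

/-!
Conventions. `V` is a unital commutative associative algebra over a field `F`, with an algebra
automorphism `S`.  A Laurent polynomial `∑ₖ cₖ λᵏ` over `V` is an element `p` of Mathlib's
`LaurentPolynomial V`, with coefficients `p.coeff k`.  A bilateral series `∑ₖ aₖ Sᵏ`
(equivalently its symbol `∑ₖ aₖ zᵏ`) is the function `k ↦ aₖ` on `ℤ`.
-/

/-- A multiplicative Poisson vertex algebra structure on the commutative algebra `V`: an
automorphism `shift` and a multiplicative `λ`-bracket `{a_λ b} = ∑ₖ (bracket a b).coeff k λᵏ`.
All axioms are written coefficient by coefficient in `λ` (and `μ`). -/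
structure MulPVA (F V : Type*) [Field F] [CommRing V] [Algebra F V] where
  /-- the automorphism `S` -/
  shift : V ≃ₐ[F] V
  /-- the bilinear `λ`-bracket with values in `V[λ, λ⁻¹]` -/
  bracket : V →ₗ[F] V →ₗ[F] LaurentPolynomial V
  /-- sesquilinearity, `{Sa_λ b} = λ⁻¹ {a_λ b}` -/
  sesq_left : ∀ (a b : V) (k : ℤ),
    (bracket (shift a) b).coeff k = (bracket a b).coeff (k + 1)
  /-- sesquilinearity, `{a_λ Sb} = λ S {a_λ b}` -/
  sesq_right : ∀ (a b : V) (k : ℤ),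
    (bracket a (shift b)).coeff k = shift ((bracket a b).coeff (k - 1))
  /-- left Leibniz rule, `{a_λ bc} = {a_λ b} c + {a_λ c} b` -/
  leibniz_left : ∀ (a b c : V) (k : ℤ),
    (bracket a (b * c)).coeff k = (bracket a b).coeff k * c + (bracket a c).coeff k * b
  /-- right Leibniz rule, `{ab_λ c} = {a_{λx} c}(|_{x=S} b) + {b_{λx} c}(|_{x=S} a)` -/
  leibniz_right : ∀ (a b c : V) (k : ℤ),
    (bracket (a * b) c).coeff k =
      (bracket a c).coeff k * (shift ^ k) b + (bracket b c).coeff k * (shift ^ k) a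
  /-- skewsymmetry, `{a_λ b} = -{b_{λ⁻¹S⁻¹} a}` with `S⁻¹` moved to the left -/
  skew : ∀ (a b : V) (k : ℤ),
    (bracket a b).coeff k = -(shift ^ k) ((bracket b a).coeff (-k))
  /-- Jacobi identity `{a_λ {b_μ c}} - {b_μ {a_λ c}} = {{a_λ b}_{λμ} c}`, coefficient of
  `λᵏ μˡ` -/
  jacobi : ∀ (a b c : V) (k l : ℤ),
    (bracket a ((bracket b c).coeff l)).coeff k - (bracket b ((bracket a c).coeff k)).coeff l =
      (bracket ((bracket a b).coeff (k - l)) c).coeff l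

/-- The value at `λ = 1` of a Laurent polynomial over `V`. -/
noncomputable def evalAtOne (F V : Type*) [Field F] [CommRing V] [Algebra F V] :
    LaurentPolynomial V →ₗ[F] V where
  toFun p := p.coeff.sum fun _ c => c
  map_add' p q := by
    rw [AddMonoidAlgebra.coeff_add]
    exact Finsupp.sum_add_index' (fun _ => rfl) (fun _ _ _ => rfl)
  map_smul' r p := by
    rw [AddMonoidAlgebra.coeff_smul, RingHom.id_apply]
    rw [Finsupp.sum_smul_index' (fun _ => rfl), Finsupp.smul_sum]

namespace MulPVA

variable {F V : Type*} [Field F] [CommRing V] [Algebra F V] (A : MulPVA F V)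

/-- The subspace `(S - 1) V` of `V`. -/
def totalDifferences : Submodule F V :=
  LinearMap.range (A.shift.toLinearMap - LinearMap.id)

/-- The space `V / (S - 1) V` of Hamiltonian functionals. -/
abbrev Functional : Type _ := V ⧸ A.totalDifferences

/-- The canonical quotient map `∫ : V → V / (S - 1) V`. -/
def integral : V →ₗ[F] A.Functional := A.totalDifferences.mkQ

/-- The bilinear map `(a, b) ↦ {a_λ b}|_{λ = 1}` on `V`. -/
noncomputable def bracketAtOne : V →ₗ[F] V →ₗ[F] V :=
  A.bracket.compr₂ (evalAtOne F V)

theorem finsuppSum_eq_finsum {M : Type*} [AddCommMonoid M] (f : ℤ →₀ M) :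
    (f.sum fun _ c => c) = ∑ᶠ k, f k :=
  (finsum_eq_sum_of_support_subset f (by simp)).symm

theorem bracketAtOne_apply (a b : V) :
    A.bracketAtOne a b = ∑ᶠ k, (A.bracket a b).coeff k :=
  finsuppSum_eq_finsum _

theorem bracketAtOne_shift_left (a b : V) :
    A.bracketAtOne (A.shift a) b = A.bracketAtOne a b := by
  simp only [bracketAtOne_apply, A.sesq_left]
  exact finsum_comp_equiv (Equiv.addRight (1 : ℤ)) (f := fun k => (A.bracket a b).coeff k)

theorem bracketAtOne_shift_right (a b : V) :
    A.bracketAtOne a (A.shift b) = A.shift (A.bracketAtOne a b) := by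
  simp only [bracketAtOne_apply, A.sesq_right]
  refine (finsum_comp_equiv (Equiv.subRight (1 : ℤ))
    (f := fun k => A.shift ((A.bracket a b).coeff k))).trans ?_
  exact (AddMonoidHom.map_finsum (A.shift : V →+ V) (A.bracket a b).coeff.finite_support).symm

/-- The action `{∫a, b} = {a_λ b}|_{λ = 1}` of Hamiltonian functionals on `V`. -/
noncomputable def action : A.Functional →ₗ[F] V →ₗ[F] V :=
  A.totalDifferences.liftQ A.bracketAtOne (by
    rintro _ ⟨a, rfl⟩
    rw [LinearMap.mem_ker]
    ext b
    simp [bracketAtOne_shift_left])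

theorem action_totalDifferences (f : A.Functional) :
    A.totalDifferences ≤ LinearMap.ker (A.integral ∘ₗ A.action f) := by
  rintro _ ⟨b, rfl⟩
  obtain ⟨a, rfl⟩ := Submodule.mkQ_surjective _ f
  rw [LinearMap.mem_ker]
  refine (Submodule.Quotient.mk_eq_zero _).2 ⟨A.bracketAtOne a b, ?_⟩
  simp [action, bracketAtOne_shift_right]

/-- The bracket `{∫a, ∫b} = ∫ {a_λ b}|_{λ = 1}` of Hamiltonian functionals. -/
noncomputable def functionalBracket (f g : A.Functional) : A.Functional :=
  A.totalDifferences.liftQ (A.integral ∘ₗ A.action f) (A.action_totalDifferences f) g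

theorem action_integral (a b : V) :
    A.action (A.integral a) b = evalAtOne F V (A.bracket a b) := rfl

theorem functionalBracket_integral (a b : V) :
    A.functionalBracket (A.integral a) (A.integral b) =
      A.integral (evalAtOne F V (A.bracket a b)) := rfl

/-- The time derivative `d/dt : V → V` of the Hamiltonian equation `du/dt = {∫h, u}`, `u ∈ V`,
associated with the Hamiltonian functional `∫h`. -/
noncomputable def timeDeriv (h : A.Functional) (u : V) : V := A.action h u

/-- `∫g` is an integral of motion of the Hamiltonian equation associated with `∫h`. -/
def IsIntegralOfMotion (h g : A.Functional) : Prop := A.functionalBracket h g = 0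

/-- The Hamiltonian equations associated with `∫g` and `∫h` are compatible: their flows
commute. -/
def Compatible (g h : A.Functional) : Prop :=
  ∀ u : V, A.timeDeriv g (A.timeDeriv h u) = A.timeDeriv h (A.timeDeriv g u)

end MulPVA

namespace PseudoDiff

variable {F V : Type*} [Field F] [CommRing V] [Algebra F V]

/-- `a ∈ V((S))`: the powers of `S` that occur are bounded below. -/
def MemLaurentPos (a : ℤ → V) : Prop := ∃ N : ℤ, ∀ k < N, a k = 0

/-- `a ∈ V((S⁻¹))`: the powers of `S` that occur are bounded above. -/
def MemLaurentNeg (a : ℤ → V) : Prop := ∃ N : ℤ, ∀ k > N, a k = 0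

/-- `a` is a pseudodifference operator, i.e. it lies in `V((S))` or in `V((S⁻¹))`. -/
def IsPseudoDiff (a : ℤ → V) : Prop := MemLaurentPos a ∨ MemLaurentNeg a

/-- The product of `V((S))` and of `V((S⁻¹))`, determined by `S ∘ f = S(f) S`:
`(a ∘ b)ₖ = ∑ₘ aₘ Sᵐ(bₖ₋ₘ)`. If both factors lie in `V((S))`, or both in `V((S⁻¹))`, the sum is
finite. -/
noncomputable def comp (S : V ≃ₐ[F] V) (a b : ℤ → V) (k : ℤ) : V :=
  ∑ᶠ m : ℤ, a m * (S ^ m) (b (k - m))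

theorem comp_support_finite_pos (S : V ≃ₐ[F] V) {a b : ℤ → V} (ha : MemLaurentPos a)
    (hb : MemLaurentPos b) (k : ℤ) :
    (Function.support fun m : ℤ => a m * (S ^ m) (b (k - m))).Finite := by
  obtain ⟨M, hM⟩ := ha
  obtain ⟨N, hN⟩ := hb
  refine (Set.finite_Icc M (k - N)).subset fun m hm => ?_
  by_contra h
  apply hm
  rcases lt_or_ge m M with h1 | h1
  · simp [hM m h1]
  · have : b (k - m) = 0 := hN _ (by
      have : ¬ m ≤ k - N := fun h2 => h ⟨h1, h2⟩
      omega)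
    simp [this]

theorem comp_support_finite_neg (S : V ≃ₐ[F] V) {a b : ℤ → V} (ha : MemLaurentNeg a)
    (hb : MemLaurentNeg b) (k : ℤ) :
    (Function.support fun m : ℤ => a m * (S ^ m) (b (k - m))).Finite := by
  obtain ⟨M, hM⟩ := ha
  obtain ⟨N, hN⟩ := hb
  refine (Set.finite_Icc (k - N) M).subset fun m hm => ?_
  by_contra h
  apply hm
  rcases lt_or_ge M m with h1 | h1
  · simp [hM m h1]
  · have : b (k - m) = 0 := hN _ (by
      have : ¬ k - N ≤ m := fun h2 => h ⟨h2, h1⟩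
      omega)
    simp [this]

/-- The powers `Lⁿ` with respect to the product of operators. -/
noncomputable def pow (S : V ≃ₐ[F] V) (L : ℤ → V) : ℕ → ℤ → V
  | 0 => Pi.single 0 1
  | n + 1 => comp S L (pow S L n)

/-- The commutator `[a, b] = a ∘ b - b ∘ a`. -/
noncomputable def commutator (S : V ≃ₐ[F] V) (a b : ℤ → V) : ℤ → V :=
  comp S a b - comp S b a

/-- The positive part `a₊ = ∑_{k ≥ 0} aₖ Sᵏ`. -/
def posPart (a : ℤ → V) (k : ℤ) : V := if 0 ≤ k then a k else 0

/-- The multiplicative residue, the coefficient of `S⁰`. -/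
def mres (a : ℤ → V) : V := a 0

/-- `hₙ = -(1/n) mres Lⁿ` for `n ≠ 0`, and `h₀ = 0`. -/
noncomputable def hamDensity (S : V ≃ₐ[F] V) (L : ℤ → V) (n : ℕ) : V :=
  if n = 0 then 0 else -((1 / (n : F)) • mres (pow S L n))

/-- A formal series `∑ c i j k zⁱ wʲ λᵏ`, bilateral in the three variables, is the function
`c`. -/
abbrev Series3 (V : Type*) := ℤ → ℤ → ℤ → V

/-- The series `L(w)`. -/
def symbolW (L : ℤ → V) : Series3 V := fun i j k => if i = 0 ∧ k = 0 then L j else 0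

/-- The series `L^*(λ/z) = ∑ₘ S⁻ᵐ(Lₘ) (λ/z)⁻ᵐ`, the symbol of the formal adjoint
`L^*(S) = ∑ₘ S⁻ᵐ ∘ Lₘ` at `λ/z`. -/
def adjointSymbol (S : V ≃ₐ[F] V) (L : ℤ → V) : Series3 V :=
  fun i j k => if j = 0 ∧ k = -i then (S ^ (-i)) (L i) else 0

/-- `G ↦ L(z) G`. -/
noncomputable def mulSymbolZ (L : ℤ → V) (G : Series3 V) : Series3 V :=
  fun i j k => ∑ᶠ m : ℤ, L m * G (i - m) j k

/-- `G ↦ L(w) G`. -/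
noncomputable def mulSymbolW (L : ℤ → V) (G : Series3 V) : Series3 V :=
  fun i j k => ∑ᶠ m : ℤ, L m * G i (j - m) k

/-- `G ↦ L(wλS) G = ∑ₘ Lₘ wᵐ λᵐ Sᵐ(G)`. -/
noncomputable def applyWLS (S : V ≃ₐ[F] V) (L : ℤ → V) (G : Series3 V) : Series3 V :=
  fun i j k => ∑ᶠ m : ℤ, L m * (S ^ m) (G i (j - m) (k - m))

/-- `G ↦ (wλS/z) G`. -/
def applyRatio (S : V ≃ₐ[F] V) (G : Series3 V) : Series3 V :=
  fun i j k => S (G (i + 1) (j - 1) (k - 1))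

/-- `G ↦ δ₊(wλS/z) G`, where `δ₊(x) = ∑_{n ≥ 0} xⁿ`. -/
noncomputable def applyDeltaPlus (S : V ≃ₐ[F] V) (G : Series3 V) : Series3 V :=
  fun i j k => ∑ᶠ n : ℕ, (S ^ n) (G (i + n) (j - n) (k - n))

/-- The right-hand side of the multiplicative 3-Adler identity,
`L(wλS) L(z) δ₊(wλS/z) (L^*(λ/z) - (wλS/z) L(w))
  - (L(z) - L(wλS) (wλS/z)) δ₊(wλS/z) L(w) L^*(λ/z)`,
where each `S` acts on everything to its right. For `L` in `V((S))` or in `V((S⁻¹))` all the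
sums that occur are finite. -/
noncomputable def adlerThreeRHS (S : V ≃ₐ[F] V) (L : ℤ → V) : Series3 V :=
  applyWLS S L (mulSymbolZ L (applyDeltaPlus S
      (adjointSymbol S L - applyRatio S (symbolW L))))
    - (mulSymbolZ L (applyDeltaPlus S (mulSymbolW L (adjointSymbol S L)))
      - applyWLS S L (applyRatio S (applyDeltaPlus S (mulSymbolW L (adjointSymbol S L)))))

/-- The multiplicative 3-Adler identity
`{L(z)_λ L(w)} = adlerThreeRHS`, where `{L(z)_λ L(w)} = ∑ᵢⱼ {Lᵢ_λ Lⱼ} zⁱ wʲ`. -/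
def IsAdlerThree (A : MulPVA F V) (L : ℤ → V) : Prop :=
  ∀ i j k : ℤ, (A.bracket (L i) (L j)).coeff k = adlerThreeRHS A.shift L i j k

end PseudoDiff

/-! ### Rearranging finite sums over the integers. -/

section

open Function (support support_add support_sub mem_support Injective)

/-! Two mechanisms carry the theorem: a trace formula that differentiates `mres Lⁿ`, and a
cancellation that turns the Adler identity into a Lax equation.

For fixed `c`, put `T(X, Y) = ∑ᵢ {Xᵢ_λ c}(|_{λ=S} Sⁱ(Y₋ᵢ))`. The right Leibniz rule and the
`S`-invariance of the pairing give `T(XX', Y) = T(X, X'Y) + T(X', YX)` (`variationTrace_comp`),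
whence `{∫ mres Lⁿ⁺¹, c} = (n+1) T(L, Lⁿ)` (`bracketAtOne_mres_pow`).

For `c = Lⱼ` the Adler identity makes every term of `T(L, Lⁿ)` a term of the triple product `L X L`,
`X = Lⁿ⁺¹`, weighted by the step functions that `δ₊` produces. Two of the four steps cancel; the
others cut out `L (XL)₊ - (LX)₊ L` (`variationTrace_of_isAdlerThree`). Since `X` commutes with `L`,
this is the Lax equation up to the factor and sign built into `hₙ`.

The operator `D = {∫hₘ, ·}` is a derivation commuting with `S`, so `D(L) = [B, L]` yields `D(Lⁿ) =
[B, Lⁿ]`. The residue of a commutator is a total difference, hence `{∫hₘ, ∫hₙ} = 0`. By the Jacobi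
identity at `λ = μ = 1`, functionals in involution have commuting flows. -/

theorem finsum_comm_of_finite {α β M : Type*} [AddCommMonoid M] {f : α → β → M}
    (hf : (support fun x : α × β => f x.1 x.2).Finite) :
    ∑ᶠ a, ∑ᶠ b, f a b = ∑ᶠ b, ∑ᶠ a, f a b := by
  rw [← finsum_curry (fun x : α × β => f x.1 x.2) hf,
    ← finsum_comp_equiv (Equiv.prodComm β α)]
  exact finsum_curry (fun x : β × α => f x.2 x.1)
    (hf.preimage (Equiv.prodComm β α).injective.injOn)

/-- A finite triple sum may be summed in the order third, first, second variable. -/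
theorem finsum_rotate_of_finite {α β γ M : Type*} [AddCommMonoid M] {f : α → β → γ → M}
    (hf : (support fun x : α × β × γ => f x.1 x.2.1 x.2.2).Finite) :
    ∑ᶠ a, ∑ᶠ b, ∑ᶠ c, f a b c = ∑ᶠ b, ∑ᶠ c, ∑ᶠ a, f a b c := by
  rw [← finsum_curry₃ (fun x : α × β × γ => f x.1 x.2.1 x.2.2) hf]
  let e : β × γ × α ≃ α × β × γ :=
    ⟨fun x => (x.2.2, x.1, x.2.1), fun x => (x.2.1, x.2.2, x.1), fun _ => rfl, fun _ => rfl⟩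
  rw [← finsum_comp_equiv e]
  exact finsum_curry₃ (fun x : β × γ × α => f x.2.2 x.1 x.2.1)
    (hf.preimage e.injective.injOn)

/-- Summation over the integers `≥ c`. -/
theorem finsum_nat_add_eq_finsum_int {R : Type*} [Semiring R] (g : ℤ → R) (c : ℤ) :
    ∑ᶠ n : ℕ, g (n + c) = ∑ᶠ n : ℤ, (if c ≤ n then 1 else 0) * g n := by
  have hinj : Injective fun n : ℕ => (n : ℤ) + c := fun a b h => by simpa using h
  rw [← finsum_mem_range hinj (f := g)]
  refine finsum_congr fun n => ?_
  have : n ∈ Set.range (fun n : ℕ => (n : ℤ) + c) ↔ c ≤ n :=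
    ⟨by rintro ⟨m, rfl⟩; simp, fun h => ⟨(n - c).toNat, by simp; omega⟩⟩
  simp only [this]
  by_cases h : c ≤ n <;> simp [h]

theorem finite_support_int_of_bounds {M : Type*} [Zero M] {f : ℤ → M} (lo hi : ℤ)
    (h : ∀ m, f m ≠ 0 → lo ≤ m ∧ m ≤ hi) : (support f).Finite :=
  (Set.finite_Icc lo hi).subset fun m hm => h m hm

theorem finite_support_int_prod_of_bounds {M : Type*} [Zero M] {f : ℤ × ℤ → M} (lo hi : ℤ)
    (h : ∀ m, f m ≠ 0 → (lo ≤ m.1 ∧ m.1 ≤ hi) ∧ (lo ≤ m.2 ∧ m.2 ≤ hi)) : (support f).Finite :=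
  ((Set.finite_Icc lo hi).prod (Set.finite_Icc lo hi)).subset fun m hm => h m hm

theorem finite_support_int_prod₃_of_bounds {M : Type*} [Zero M] {f : ℤ × ℤ × ℤ → M} (lo hi : ℤ)
    (h : ∀ m, f m ≠ 0 →
      (lo ≤ m.1 ∧ m.1 ≤ hi) ∧ (lo ≤ m.2.1 ∧ m.2.1 ≤ hi) ∧ (lo ≤ m.2.2 ∧ m.2.2 ≤ hi)) :
    (support f).Finite :=
  ((Set.finite_Icc lo hi).prod ((Set.finite_Icc lo hi).prod (Set.finite_Icc lo hi))).subset
    fun m hm => h m hm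

/-! ### The algebra of pseudodifference operators. -/

namespace PseudoDiff

variable {F V : Type*} [Field F] [CommRing V] [Algebra F V] (S : V ≃ₐ[F] V)

theorem zpow_add_apply (m n : ℤ) (x : V) : (S ^ (m + n)) x = (S ^ m) ((S ^ n) x) := by
  rw [zpow_add, AlgEquiv.mul_apply]

theorem ne_zero_of_zpow_ne_zero {m : ℤ} {x : V} (h : (S ^ m) x ≠ 0) : x ≠ 0 := by
  rintro rfl; exact h (map_zero _)

theorem zpow_finsum {α : Type*} (m : ℤ) {f : α → V} (hf : (support f).Finite) :
    (S ^ m) (∑ᶠ i, f i) = ∑ᶠ i, (S ^ m) (f i) :=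
  map_finsum (S ^ m) hf

/-- The support of `a` is bounded below if `ε = 1`, and bounded above if `ε = -1`. -/
def SuppBounded (ε : ℤˣ) (a : ℤ → V) : Prop := ∃ N : ℤ, ∀ k, a k ≠ 0 → N ≤ ε * k

/-- The sign `ε` lets a single argument serve both `V((S))` and `V((S⁻¹))` from here on. -/
theorem IsPseudoDiff.exists_suppBounded {a : ℤ → V} (ha : IsPseudoDiff a) :
    ∃ ε, SuppBounded ε a := by
  rcases ha with ⟨N, h⟩ | ⟨N, h⟩
  · refine ⟨1, N, fun k hk => ?_⟩
    by_contra hc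
    exact hk (h k (by simpa using hc))
  · refine ⟨-1, -N, fun k hk => ?_⟩
    by_contra hc
    exact hk (h k (by simp at hc; omega))

variable {S} {ε : ℤˣ} {a b c : ℤ → V}

theorem SuppBounded.posPart (ha : SuppBounded ε a) : SuppBounded ε (posPart a) := by
  obtain ⟨N, h⟩ := ha
  exact ⟨N, fun k hk => h k fun h0 => hk (by simp [PseudoDiff.posPart, h0])⟩

theorem SuppBounded.finite_comp (ha : SuppBounded ε a) (hb : SuppBounded ε b) (k : ℤ) :
    (support fun m : ℤ => a m * (S ^ m) (b (k - m))).Finite := by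
  obtain ⟨N, h⟩ := ha
  obtain ⟨N', h'⟩ := hb
  -- The degrees of the factors add up to `k`, so one-sided bounds on them confine `m`. The box is
  -- symmetric and generous so that it suits both values of `ε`; the later finiteness proofs follow
  -- the same pattern.
  refine finite_support_int_of_bounds (-(N.natAbs + N'.natAbs + k.natAbs)) (N.natAbs + N'.natAbs + k.natAbs) fun m hm => ?_
  have h1 := h _ (left_ne_zero_of_mul hm)
  have h2 := h' _ (ne_zero_of_zpow_ne_zero S (right_ne_zero_of_mul hm))
  rcases Int.units_eq_one_or ε with rfl | rfl <;> simp at h1 h2 <;> omega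

theorem SuppBounded.comp (ha : SuppBounded ε a) (hb : SuppBounded ε b) :
    SuppBounded ε (comp S a b) := by
  obtain ⟨N, h⟩ := ha
  obtain ⟨N', h'⟩ := hb
  refine ⟨N + N', fun k hk => ?_⟩
  obtain ⟨m, hm⟩ : ∃ m : ℤ, a m * (S ^ m) (b (k - m)) ≠ 0 := by
    by_contra! h0
    exact hk (finsum_eq_zero_of_forall_eq_zero h0)
  have h1 := h _ (left_ne_zero_of_mul hm)
  have h2 := h' _ (ne_zero_of_zpow_ne_zero S (right_ne_zero_of_mul hm))
  linarith [mul_sub (ε : ℤ) k m]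

theorem suppBounded_one : SuppBounded ε (Pi.single 0 1 : ℤ → V) :=
  ⟨0, fun k hk => by
    by_cases h : k = 0
    · simp [h]
    · simp [h] at hk⟩

theorem SuppBounded.pow (ha : SuppBounded ε a) (n : ℕ) : SuppBounded ε (pow S a n) := by
  induction n with
  | zero => exact suppBounded_one
  | succ n ih => exact ha.comp ih

theorem one_comp (b : ℤ → V) : comp S (Pi.single 0 1) b = b := by
  ext k
  refine (finsum_eq_single _ 0 fun m hm => ?_).trans ?_ <;> simp [*]

theorem comp_one (a : ℤ → V) : comp S a (Pi.single 0 1) = a := by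
  ext k
  refine (finsum_eq_single _ k fun m hm => ?_).trans ?_
  · rw [Pi.single_eq_of_ne (by omega), map_zero, mul_zero]
  · simp

theorem comp_sub (ha : SuppBounded ε a) (hb : SuppBounded ε b) (hc : SuppBounded ε c) :
    comp S a (b - c) = comp S a b - comp S a c := by
  ext k
  simp only [comp, Pi.sub_apply, map_sub, mul_sub]
  exact finsum_sub_distrib (ha.finite_comp hb k) (ha.finite_comp hc k)

theorem sub_comp (ha : SuppBounded ε a) (hb : SuppBounded ε b) (hc : SuppBounded ε c) :
    comp S (a - b) c = comp S a c - comp S b c := by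
  ext k
  simp only [comp, Pi.sub_apply, sub_mul]
  exact finsum_sub_distrib (ha.finite_comp hc k) (hb.finite_comp hc k)

theorem SuppBounded.finite_comp₃ (ha : SuppBounded ε a) (hb : SuppBounded ε b)
    (hc : SuppBounded ε c) (k : ℤ) :
    (support fun x : ℤ × ℤ =>
      a x.1 * (S ^ x.1) (b (x.2 - x.1)) * (S ^ x.2) (c (k - x.2))).Finite := by
  obtain ⟨N, h⟩ := ha
  obtain ⟨N', h'⟩ := hb
  obtain ⟨N'', h''⟩ := hc
  refine finite_support_int_prod_of_bounds (-(N.natAbs + N'.natAbs + N''.natAbs + k.natAbs))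
    (N.natAbs + N'.natAbs + N''.natAbs + k.natAbs) fun m hm => ?_
  have h1 := h _ (left_ne_zero_of_mul (left_ne_zero_of_mul hm))
  have h2 := h' _ (ne_zero_of_zpow_ne_zero S (right_ne_zero_of_mul (left_ne_zero_of_mul hm)))
  have h3 := h'' _ (ne_zero_of_zpow_ne_zero S (right_ne_zero_of_mul hm))
  rcases Int.units_eq_one_or ε with rfl | rfl <;> simp at h1 h2 h3 <;> omega

theorem comp_apply_mul (ha : SuppBounded ε a) (hb : SuppBounded ε b) (t : ℤ) (x : V) :
    comp S a b t * x = ∑ᶠ q : ℤ, a q * (S ^ q) (b (t - q)) * x :=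
  finsum_mul' _ _ (ha.finite_comp hb t)

theorem comp_apply_shift (hb : SuppBounded ε b) (hc : SuppBounded ε c) (x : V) (q j : ℤ) :
    x * (S ^ q) (comp S b c (j - q)) =
      ∑ᶠ t : ℤ, x * (S ^ q) (b (t - q)) * (S ^ t) (c (j - t)) := by
  rw [← finsum_comp_equiv (Equiv.addRight q), comp, zpow_finsum S q (hb.finite_comp hc _),
    mul_finsum']
  · refine finsum_congr fun r => ?_
    simp only [Equiv.coe_addRight]
    rw [add_comm r q, zpow_add_apply, map_mul, mul_assoc,
      add_sub_cancel_left, sub_sub]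
  · exact (hb.finite_comp hc (j - q)).subset
      fun r hr => ne_zero_of_zpow_ne_zero S hr

/-- Both bracketings are the same double sum over the accumulated degrees `q` and `t`, taken in
opposite orders. -/
theorem comp_assoc (ha : SuppBounded ε a) (hb : SuppBounded ε b) (hc : SuppBounded ε c) :
    comp S (comp S a b) c = comp S a (comp S b c) := by
  ext k
  calc comp S (comp S a b) c k
      = ∑ᶠ t : ℤ, ∑ᶠ q : ℤ, a q * (S ^ q) (b (t - q)) * (S ^ t) (c (k - t)) :=
        finsum_congr fun t => comp_apply_mul ha hb t _
    _ = ∑ᶠ q : ℤ, ∑ᶠ t : ℤ, a q * (S ^ q) (b (t - q)) * (S ^ t) (c (k - t)) :=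
        (finsum_comm_of_finite (ha.finite_comp₃ hb hc k)).symm
    _ = comp S a (comp S b c) k :=
        finsum_congr fun q => (comp_apply_shift hb hc _ q k).symm

theorem zpow_apply_sub_mem {W : Submodule F V} (hW : ∀ y, S y - y ∈ W) (m : ℤ) (y : V) :
    (S ^ m) y - y ∈ W := by
  induction m with
  | zero => simp
  | succ n ih =>
    have h : (S ^ ((n : ℤ) + 1)) y = S ((S ^ (n : ℤ)) y) := by
      rw [add_comm, zpow_add_apply, zpow_one]
    rw [h]
    simpa using W.add_mem (hW ((S ^ (n : ℤ)) y)) ih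
  | pred n ih =>
    have h := zpow_add_apply S 1 (-(n : ℤ) - 1) y
    rw [zpow_one, add_sub_cancel] at h
    have := W.sub_mem ih (hW ((S ^ (-(n : ℤ) - 1)) y))
    rw [← h] at this
    simpa using this

theorem pow_comp_pow (ha : SuppBounded ε a) (m n : ℕ) :
    comp S (pow S a m) (pow S a n) = pow S a (m + n) := by
  induction m with
  | zero => rw [pow, one_comp, zero_add]
  | succ m ih => rw [pow, comp_assoc ha (ha.pow m) (ha.pow n), ih, ← pow, add_right_comm]

/-- The multiplicative residue of a commutator is a total difference. -/
theorem mres_commutator_mem {W : Submodule F V} (hW : ∀ y, S y - y ∈ W)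
    (ha : SuppBounded ε a) (hb : SuppBounded ε b) : mres (commutator S a b) ∈ W := by
  have hfin := (hb.finite_comp (S := S) ha 0).preimage (Equiv.neg ℤ).injective.injOn
  -- The `m`-th term of `mres (ab)` is `Sᵐ` applied to the `(-m)`-th term of `mres (ba)`, so the two
  -- residues pair off into differences `Sᵐ y - y`.
  have h : mres (commutator S a b) =
      ∑ᶠ m : ℤ, ((S ^ m) (b (-m) * (S ^ (-m)) (a m)) - b (-m) * (S ^ (-m)) (a m)) := by
    have h1 : comp S a b 0 = ∑ᶠ m : ℤ, (S ^ m) (b (-m) * (S ^ (-m)) (a m)) := by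
      refine finsum_congr fun m => ?_
      rw [map_mul, ← zpow_add_apply, add_neg_cancel, zpow_zero, AlgEquiv.one_apply, zero_sub,
        mul_comm]
    have h2 : comp S b a 0 = ∑ᶠ m : ℤ, b (-m) * (S ^ (-m)) (a m) := by
      rw [comp, ← finsum_comp_equiv (Equiv.neg ℤ)]
      simp
    rw [mres, commutator, Pi.sub_apply, h1, h2, finsum_sub_distrib]
    · refine hfin.subset fun m hm => ?_
      simpa using ne_zero_of_zpow_ne_zero S hm
    · refine hfin.subset fun m hm => ?_
      simpa using hm
  rw [h]
  exact finsum_induction (· ∈ W) W.zero_mem (fun _ _ => W.add_mem)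
    fun m => zpow_apply_sub_mem hW m _

/-- A derivation of `V` commuting with `S` acts on products of operators by the Leibniz rule. -/
theorem map_comp_of_leibniz {D : V →ₗ[F] V} (hD : ∀ x y, D (x * y) = D x * y + x * D y)
    (hS : ∀ x, D (S x) = S (D x)) (ha : SuppBounded ε a) (hb : SuppBounded ε b) :
    (fun k => D (comp S a b k)) =
      comp S (fun k => D (a k)) b + comp S a (fun k => D (b k)) := by
  have hpow (m : ℤ) : ∀ x, D ((S ^ m) x) = (S ^ m) (D x) := by
    induction m with
    | zero => simp
    | succ n ih =>
      intro x
      rw [zpow_add_apply, ih, zpow_one, hS, zpow_add_apply, zpow_one]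
    | pred n ih =>
      intro x
      have h : D x = S (D (S⁻¹ x)) := by rw [← hS]; exact congrArg D (S.apply_symm_apply x).symm
      rw [sub_eq_add_neg, zpow_add_apply, ih, zpow_neg_one, zpow_add_apply, zpow_neg_one, h]
      exact congrArg _ (S.symm_apply_apply _).symm
  have ha' : SuppBounded ε fun k => D (a k) :=
    ha.imp fun N h k hk => h k fun h0 => hk (by simp [h0])
  have hb' : SuppBounded ε fun k => D (b k) :=
    hb.imp fun N h k hk => h k fun h0 => hk (by simp [h0])
  ext k
  rw [Pi.add_apply, comp, comp, comp, map_finsum D (ha.finite_comp hb k),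
    ← finsum_add_distrib (ha'.finite_comp hb k) (ha.finite_comp hb' k)]
  exact finsum_congr fun m => by rw [hD, hpow]

/-- Both `D` and `[b, ·]` are derivations of the operator product, so agreement on `a` propagates to
its powers. -/
theorem map_pow_of_leibniz {D : V →ₗ[F] V} (hD : ∀ x y, D (x * y) = D x * y + x * D y)
    (hS : ∀ x, D (S x) = S (D x)) (ha : SuppBounded ε a) (hb : SuppBounded ε b)
    (h : (fun k => D (a k)) = commutator S b a) (n : ℕ) :
    (fun k => D (pow S a n k)) = commutator S b (pow S a n) := by
  induction n with
  | zero =>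
    have h1 : D 1 = 0 := by simpa using hD 1 1
    ext k
    rw [commutator, pow, one_comp, comp_one, sub_self, Pi.zero_apply]
    by_cases hk : k = 0
    · simp [hk, h1]
    · simp [hk]
  | succ n ih =>
    have hn := ha.pow (S := S) n
    simp only [pow]
    rw [map_comp_of_leibniz hD hS ha hn, h, ih, commutator, commutator, commutator,
      sub_comp (hb.comp ha) (ha.comp hb) hn, comp_sub ha (hb.comp hn) (hn.comp hb),
      comp_assoc hb ha hn, comp_assoc ha hb hn, comp_assoc ha hn hb]
    abel

end PseudoDiff

/-! ### The bracket at `λ = 1` and the variation of residues. -/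

namespace MulPVA

open PseudoDiff

variable {F V : Type*} [Field F] [CommRing V] [Algebra F V] (A : MulPVA F V)

theorem bracketAtOne_mul_right (a x y : V) :
    A.bracketAtOne a (x * y) = A.bracketAtOne a x * y + x * A.bracketAtOne a y := by
  have hx := (A.bracket a x).coeff.hasFiniteSupport
  have hy := (A.bracket a y).coeff.hasFiniteSupport
  rw [bracketAtOne_apply, bracketAtOne_apply, bracketAtOne_apply, finsum_mul' _ _ hx,
    mul_finsum' _ _ hy, ← finsum_add_distrib]
  · exact finsum_congr fun k => by rw [A.leibniz_left, mul_comm x]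
  · exact hx.subset fun k hk => left_ne_zero_of_mul hk
  · exact hy.subset fun k hk => right_ne_zero_of_mul hk

/-- The Jacobi identity at `λ = μ = 1`. -/
theorem bracketAtOne_jacobi (a b c : V) :
    A.bracketAtOne a (A.bracketAtOne b c) - A.bracketAtOne b (A.bracketAtOne a c) =
      A.bracketAtOne (A.bracketAtOne a b) c := by
  have hsupp (x y : V) : (support fun k => (A.bracket x y).coeff k).Finite :=
    (A.bracket x y).coeff.hasFiniteSupport
  have hright (x y z : V) : (A.bracketAtOne x (A.bracketAtOne y z)) =
      ∑ᶠ l, ∑ᶠ k, (A.bracket x ((A.bracket y z).coeff l)).coeff k := by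
    rw [A.bracketAtOne_apply y z, map_finsum (A.bracketAtOne x) (hsupp y z)]
    exact finsum_congr fun l => A.bracketAtOne_apply x _
  have hfin (x y z : V) : (support fun p : ℤ × ℤ =>
      (A.bracket x ((A.bracket y z).coeff p.1)).coeff p.2).Finite := by
    refine ((hsupp y z).biUnion fun l _ =>
      (hsupp x ((A.bracket y z).coeff l)).image (Prod.mk l)).subset fun p hp => ?_
    simp only [Set.mem_iUnion]
    refine ⟨p.1, fun h0 => hp ?_, p.2, hp, rfl⟩
    simp only at h0
    simp [h0]
  have hleft : A.bracketAtOne (A.bracketAtOne a b) c =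
      ∑ᶠ l, ∑ᶠ k, (A.bracket ((A.bracket a b).coeff (k - l)) c).coeff l := by
    have hf : (support fun p : ℤ × ℤ =>
        (A.bracket ((A.bracket a b).coeff p.1) c).coeff p.2).Finite := by
      refine ((hsupp a b).biUnion fun l _ =>
        (hsupp ((A.bracket a b).coeff l) c).image (Prod.mk l)).subset fun p hp => ?_
      simp only [Set.mem_iUnion]
      refine ⟨p.1, fun h0 => hp ?_, p.2, hp, rfl⟩
      simp only at h0
      simp [h0]
    calc A.bracketAtOne (A.bracketAtOne a b) c
        = ∑ᶠ k, A.bracketAtOne ((A.bracket a b).coeff k) c := by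
          rw [A.bracketAtOne_apply a b]
          exact map_finsum (A.bracketAtOne.flip c) (hsupp a b)
      _ = ∑ᶠ k, ∑ᶠ l, (A.bracket ((A.bracket a b).coeff k) c).coeff l :=
          finsum_congr fun k => A.bracketAtOne_apply _ c
      _ = ∑ᶠ l, ∑ᶠ k, (A.bracket ((A.bracket a b).coeff k) c).coeff l :=
          finsum_comm_of_finite hf
      -- In `{{a_λ b}_{λμ} c}` the outer variable contributes `(λμ)ˡ`, leaving `λᵏ⁻ˡ` for the inner
      -- bracket; hence the shift by `l`.
      _ = _ := finsum_congr fun l => (finsum_comp_equiv (Equiv.subRight l)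
          (f := fun k => (A.bracket ((A.bracket a b).coeff k) c).coeff l)).symm
  have hfin' (x y z : V) : (support fun p : ℤ × ℤ =>
      (A.bracket x ((A.bracket y z).coeff p.2)).coeff p.1).Finite :=
    (hfin x y z).preimage (Equiv.prodComm ℤ ℤ).injective.injOn
  rw [hright a b c, hright b a c, hleft, finsum_comm_of_finite
      (f := fun l k => (A.bracket b ((A.bracket a c).coeff l)).coeff k) (hfin b a c),
    ← finsum_curry _ (hfin a b c), ← finsum_curry (fun p : ℤ × ℤ =>
      (A.bracket b ((A.bracket a c).coeff p.2)).coeff p.1) (hfin' b a c),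
    ← finsum_sub_distrib (hfin a b c) (hfin' b a c), finsum_curry]
  · exact finsum_congr fun l => finsum_congr fun k => A.jacobi a b c k l
  · exact ((hfin a b c).union (hfin' b a c)).subset (support_sub _ _)

/-- The Jacobi identity, read as saying that functionals act on `V` by a bracket-preserving action.
-/
theorem action_functionalBracket (f g : A.Functional) (c : V) :
    A.action (A.functionalBracket f g) c =
      A.action f (A.action g c) - A.action g (A.action f c) := by
  obtain ⟨a, rfl⟩ := Submodule.mkQ_surjective _ f
  obtain ⟨b, rfl⟩ := Submodule.mkQ_surjective _ g
  exact (A.bracketAtOne_jacobi a b c).symm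

theorem compatible_of_functionalBracket_eq_zero {f g : A.Functional}
    (h : A.functionalBracket f g = 0) : A.Compatible f g := fun u => by
  have := A.action_functionalBracket f g u
  rw [h, map_zero, LinearMap.zero_apply] at this
  exact sub_eq_zero.1 this.symm

/-- `(a, b) ↦ {a_λ c}(|_{λ = S} b)`. -/
noncomputable def bracketShift (c a b : V) : V :=
  ∑ᶠ k : ℤ, (A.bracket a c).coeff k * (A.shift ^ k) b

theorem finite_support_bracketShift (c a b : V) :
    (support fun k : ℤ => (A.bracket a c).coeff k * (A.shift ^ k) b).Finite :=
  (A.bracket a c).coeff.hasFiniteSupport.subset fun _ hk => left_ne_zero_of_mul hk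

theorem bracketShift_one (c a : V) : A.bracketShift c a 1 = A.bracketAtOne a c := by
  simp [bracketShift, bracketAtOne_apply]

theorem bracketShift_add_left (c a a' b : V) :
    A.bracketShift c (a + a') b = A.bracketShift c a b + A.bracketShift c a' b := by
  rw [bracketShift, bracketShift, bracketShift, ← finsum_add_distrib
    (A.finite_support_bracketShift c a b) (A.finite_support_bracketShift c a' b)]
  exact finsum_congr fun k => by simp [add_mul]

theorem bracketShift_add_right (c a b b' : V) :
    A.bracketShift c a (b + b') = A.bracketShift c a b + A.bracketShift c a b' := by
  rw [bracketShift, bracketShift, bracketShift, ← finsum_add_distrib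
    (A.finite_support_bracketShift c a b) (A.finite_support_bracketShift c a b')]
  exact finsum_congr fun k => by simp [mul_add]

/-- `bracketShift` as a biadditive map. -/
noncomputable def bracketShiftHom (c : V) : V →+ V →+ V :=
  AddMonoidHom.mk' (fun a => AddMonoidHom.mk' (A.bracketShift c a)
    (A.bracketShift_add_right c a)) fun a a' => by
      ext b; exact A.bracketShift_add_left c a a' b

theorem bracketShiftHom_apply (c a b : V) :
    A.bracketShiftHom c a b = A.bracketShift c a b := rfl

theorem bracketShift_mul_left (c a a' b : V) :
    A.bracketShift c (a * a') b = A.bracketShift c a (a' * b) + A.bracketShift c a' (a * b) := by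
  rw [bracketShift, bracketShift, bracketShift, ← finsum_add_distrib
    (A.finite_support_bracketShift c a _) (A.finite_support_bracketShift c a' _)]
  exact finsum_congr fun k => by rw [A.leibniz_right, map_mul, map_mul]; ring

theorem bracketShift_shift_left (c a b : V) :
    A.bracketShift c (A.shift a) (A.shift b) = A.bracketShift c a b := by
  rw [bracketShift, bracketShift, ← finsum_comp_equiv (Equiv.addRight (1 : ℤ))
    (f := fun k => (A.bracket a c).coeff k * (A.shift ^ k) b)]
  refine finsum_congr fun k => ?_
  simp only [Equiv.coe_addRight]
  rw [A.sesq_left, zpow_add_apply, zpow_one]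

/-- The factor `λ⁻¹` from sesquilinearity in the first entry absorbs the extra shift of the second.
This invariance is what makes the trace cyclic. -/
theorem bracketShift_zpow (c : V) (p : ℤ) (a b : V) :
    A.bracketShift c ((A.shift ^ p) a) ((A.shift ^ p) b) = A.bracketShift c a b := by
  induction p with
  | zero => simp
  | succ n ih =>
    rw [add_comm, zpow_add_apply, zpow_add_apply, zpow_one, bracketShift_shift_left, ih]
  | pred n ih =>
    have h (y : V) := zpow_add_apply A.shift 1 (-(n : ℤ) - 1) y
    simp only [zpow_one, add_sub_cancel] at h
    rw [h, h, bracketShift_shift_left] at ih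
    exact ih

/-- The trace `∑ᵢ {Xᵢ_λ c}(|_{λ = S} Sⁱ(Y₋ᵢ))` of the variation of `X` composed with `Y`. -/
noncomputable def variationTrace (c : V) (X Y : ℤ → V) : V :=
  ∑ᶠ i : ℤ, A.bracketShift c (X i) ((A.shift ^ i) (Y (-i)))

theorem bracketShift_zero_left (c b : V) : A.bracketShift c 0 b = 0 :=
  by rw [← bracketShiftHom_apply, map_zero, AddMonoidHom.zero_apply]

theorem bracketShift_zero_right (c a : V) : A.bracketShift c a 0 = 0 :=
  by rw [← bracketShiftHom_apply, map_zero]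

theorem variationTrace_one (c : V) (X : ℤ → V) :
    A.variationTrace c X (Pi.single 0 1) = A.bracketAtOne (mres X) c := by
  refine (finsum_eq_single _ 0 fun i hi => ?_).trans ?_
  · rw [Pi.single_eq_of_ne (by omega), map_zero, bracketShift_zero_right]
  · simp [bracketShift_one, mres]

/-- The Leibniz rule varies one factor of `X X'` at a time; the unvaried factors are then moved
cyclically behind the varied one. -/
theorem variationTrace_comp {ε : ℤˣ} {X X' Y : ℤ → V} (hX : SuppBounded ε X)
    (hX' : SuppBounded ε X') (hY : SuppBounded ε Y) (c : V) :
    A.variationTrace c (comp A.shift X X') Y =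
      A.variationTrace c X (comp A.shift X' Y) + A.variationTrace c X' (comp A.shift Y X) := by
  obtain ⟨N, h⟩ := hX
  obtain ⟨N', h'⟩ := hX'
  obtain ⟨N'', h''⟩ := hY
  -- The degrees `m`, `i - m` and `-i` sum to zero, so bounds on one side bound all of them on both.
  have hfin : {x : ℤ × ℤ | X x.2 ≠ 0 ∧ X' (x.1 - x.2) ≠ 0 ∧ Y (-x.1) ≠ 0}.Finite := by
    refine ((Set.finite_Icc (-(N.natAbs + N'.natAbs + N''.natAbs : ℤ))
      (N.natAbs + N'.natAbs + N''.natAbs)).prod (Set.finite_Icc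
        (-(N.natAbs + N'.natAbs + N''.natAbs : ℤ)) (N.natAbs + N'.natAbs + N''.natAbs))).subset ?_
    rintro ⟨i, m⟩ ⟨h1, h2, h3⟩
    replace h1 := h _ h1
    replace h2 := h' _ h2
    replace h3 := h'' _ h3
    simp only [Set.mem_prod, Set.mem_Icc]
    rcases Int.units_eq_one_or ε with rfl | rfl <;> simp at h1 h2 h3 <;> omega
  have hX : SuppBounded ε X := ⟨N, h⟩
  have hX' : SuppBounded ε X' := ⟨N', h'⟩
  have hY : SuppBounded ε Y := ⟨N'', h''⟩
  -- In `f` the variation falls on the factor from `X`, in `g` on the one from `X'`.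
  let f (i m : ℤ) : V :=
    A.bracketShift c (X m) ((A.shift ^ m) (X' (i - m)) * (A.shift ^ i) (Y (-i)))
  let g (i m : ℤ) : V :=
    A.bracketShift c ((A.shift ^ m) (X' (i - m))) (X m * (A.shift ^ i) (Y (-i)))
  have hf : (support fun x : ℤ × ℤ => f x.1 x.2).Finite := by
    refine hfin.subset fun x hx => ⟨fun h0 => hx ?_, fun h0 => hx ?_, fun h0 => hx ?_⟩ <;>
    simp [f, h0, bracketShift_zero_left, bracketShift_zero_right]
  have hg : (support fun x : ℤ × ℤ => g x.1 x.2).Finite := by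
    refine hfin.subset fun x hx => ⟨fun h0 => hx ?_, fun h0 => hx ?_, fun h0 => hx ?_⟩ <;>
    simp [g, h0, bracketShift_zero_left, bracketShift_zero_right]
  have h1 (i : ℤ) : A.bracketShift c (comp A.shift X X' i) ((A.shift ^ i) (Y (-i))) =
      ∑ᶠ m, (f i m + g i m) := by
    refine (map_finsum ((A.bracketShiftHom c).flip ((A.shift ^ i) (Y (-i))))
      (hX.finite_comp hX' i)).trans (finsum_congr fun m => ?_)
    exact A.bracketShift_mul_left c _ _ _
  have h2 (m : ℤ) : A.bracketShift c (X m) ((A.shift ^ m) (comp A.shift X' Y (-m))) =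
      ∑ᶠ i, f i m := by
    have h3 := comp_apply_shift (S := A.shift) hX' hY 1 m 0
    simp only [one_mul, zero_sub] at h3
    rw [h3]
    refine map_finsum (A.bracketShiftHom c (X m)) ?_
    refine (finite_support_int_of_bounds (-(N'.natAbs + N''.natAbs + m.natAbs))
      (N'.natAbs + N''.natAbs + m.natAbs) fun i hi => ?_)
    have h1 := h' _ (ne_zero_of_zpow_ne_zero _ (left_ne_zero_of_mul hi))
    have h2 := h'' _ (ne_zero_of_zpow_ne_zero _ (right_ne_zero_of_mul hi))
    rcases Int.units_eq_one_or ε with rfl | rfl <;> simp at h1 h2 <;> omega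
  -- With `r = i - m`, the common shift `Sᵐ` in `g` drops out by invariance, and the sum over `m`
  -- assembles `Y X`.
  have h3 (r : ℤ) : A.bracketShift c (X' r) ((A.shift ^ r) (comp A.shift Y X (-r))) =
      ∑ᶠ m, g (r + m) m := by
    have hc := hY.finite_comp (S := A.shift) hX (-r)
    let e : ℤ ≃ ℤ := Equiv.subLeft (-r)
    rw [comp, zpow_finsum _ _ hc, ← finsum_comp_equiv e]
    refine (map_finsum (A.bracketShiftHom c (X' r)) ?_).trans (finsum_congr fun m => ?_)
    · refine (hc.preimage e.injective.injOn).subset fun m hm => ?_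
      exact ne_zero_of_zpow_ne_zero _ hm
    · simp only [g, e, Equiv.subLeft_apply, bracketShiftHom_apply]
      have e : X m * (A.shift ^ (r + m)) (Y (-(r + m))) = (A.shift ^ m) ((A.shift ^ r)
          (Y (-r - m) * (A.shift ^ (-r - m)) (X (-r - (-r - m))))) := by
        rw [← zpow_add_apply, map_mul, ← zpow_add_apply, add_comm m r, sub_sub_cancel,
          show r + m + (-r - m) = 0 by ring, neg_add', zpow_zero, AlgEquiv.one_apply, mul_comm]
      rw [e, add_sub_cancel_right, bracketShift_zpow]
  have hfg : (support fun x : ℤ × ℤ => f x.1 x.2 + g x.1 x.2).Finite :=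
    (hf.union hg).subset (support_add _ _)
  calc A.variationTrace c (comp A.shift X X') Y
      = ∑ᶠ i, ∑ᶠ m, (f i m + g i m) := finsum_congr h1
    _ = (∑ᶠ i, ∑ᶠ m, f i m) + ∑ᶠ i, ∑ᶠ m, g i m := by
        rw [← finsum_curry _ hfg, finsum_add_distrib hf hg, finsum_curry _ hf,
          finsum_curry _ hg]
    _ = (∑ᶠ m, ∑ᶠ i, f i m) + ∑ᶠ r, ∑ᶠ m, g (r + m) m := by
        congr 1
        · exact finsum_comm_of_finite hf
        · let e : ℤ × ℤ ≃ ℤ × ℤ :=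
            ⟨fun x => (x.1 + x.2, x.2), fun x => (x.1 - x.2, x.2), fun x => by simp,
              fun x => by simp⟩
          rw [← finsum_curry _ hg, ← finsum_comp_equiv e]
          exact finsum_curry (fun x : ℤ × ℤ => g (x.1 + x.2) x.2)
            (hg.preimage e.injective.injOn)
    _ = _ := by
        rw [variationTrace, variationTrace, finsum_congr h2, finsum_congr h3]

/-- Peeling one factor `L` off the first argument costs one copy of the trace and passes that `L` to
the second argument; allowing an arbitrary power `k` there keeps the induction going. -/
theorem variationTrace_pow {ε : ℤˣ} {L : ℤ → V} (hL : SuppBounded ε L) (c : V) (n k : ℕ) :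
    A.variationTrace c (pow A.shift L (n + 1)) (pow A.shift L k) =
      (n + 1 : ℕ) • A.variationTrace c L (pow A.shift L (n + k)) := by
  induction n generalizing k with
  | zero => simp [pow, comp_one]
  | succ n ih =>
    have h : comp A.shift (pow A.shift L k) L = pow A.shift L (k + 1) := by
      simpa [pow, comp_one] using pow_comp_pow (S := A.shift) hL k 1
    rw [pow, A.variationTrace_comp hL (hL.pow _) (hL.pow _), h, ih (k + 1),
      succ_nsmul' _ (n + 1), pow_comp_pow hL, add_right_comm n 1 k, add_assoc n k 1]

/-- The variational formula for the functional `∫ mres Lⁿ⁺¹`. -/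
theorem bracketAtOne_mres_pow {ε : ℤˣ} {L : ℤ → V} (hL : SuppBounded ε L) (c : V) (n : ℕ) :
    A.bracketAtOne (mres (pow A.shift L (n + 1))) c =
      (n + 1 : ℕ) • A.variationTrace c L (pow A.shift L n) := by
  simpa [pow, variationTrace_one] using A.variationTrace_pow hL c n 0

end MulPVA

/-! ### The Adler identity in coefficients. -/

theorem finsum_sub_distrib₂ {α β M : Type*} [AddCommGroup M] {f g : α → β → M}
    (hf : (support fun x : α × β => f x.1 x.2).Finite)
    (hg : (support fun x : α × β => g x.1 x.2).Finite) :
    ∑ᶠ a, ∑ᶠ b, (f a b - g a b) = (∑ᶠ a, ∑ᶠ b, f a b) - ∑ᶠ a, ∑ᶠ b, g a b := by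
  rw [← finsum_curry _ hf, ← finsum_curry _ hg, ← finsum_sub_distrib hf hg]
  exact (finsum_curry (fun x : α × β => f x.1 x.2 - g x.1 x.2)
    ((hf.union hg).subset (support_sub _ _))).symm

theorem finsum_sub_distrib₃ {α β γ M : Type*} [AddCommGroup M] {f g : α → β → γ → M}
    (hf : (support fun x : α × β × γ => f x.1 x.2.1 x.2.2).Finite)
    (hg : (support fun x : α × β × γ => g x.1 x.2.1 x.2.2).Finite) :
    ∑ᶠ a, ∑ᶠ b, ((∑ᶠ c, f a b c) - ∑ᶠ c, g a b c) =
      (∑ᶠ a, ∑ᶠ b, ∑ᶠ c, f a b c) - ∑ᶠ a, ∑ᶠ b, ∑ᶠ c, g a b c := by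
  rw [← finsum_curry₃ _ hf, ← finsum_curry₃ _ hg, ← finsum_sub_distrib hf hg,
    finsum_curry₃ _ ((hf.union hg).subset (support_sub _ _))]
  refine finsum_congr fun a => finsum_congr fun b => (finsum_sub_distrib ?_ ?_).symm
  · exact hf.preimage (f := fun c => (a, b, c)) fun _ _ _ _ h => by simpa using h
  · exact hg.preimage (f := fun c => (a, b, c)) fun _ _ _ _ h => by simpa using h

namespace PseudoDiff

variable {F V : Type*} [Field F] [CommRing V] [Algebra F V] {S : V ≃ₐ[F] V}

/-- `δ₊(wλS/z) (L^*(λ/z) - (wλS/z) L(w))`. -/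
theorem applyDeltaPlus_adjoint_sub_ratio (L : ℤ → V) (i j k : ℤ) :
    applyDeltaPlus S (adjointSymbol S L - applyRatio S (symbolW L)) i j k =
      if k = -i then ((if 0 ≤ j then 1 else 0) - (if i + 1 ≤ 0 then 1 else 0)) *
        (S ^ k) (L (j - k)) else 0 := by
  -- Each symbol lets only one term of the geometric series survive: `n = j` for the adjoint and `n
  -- = -i - 1` for the ratio. If that number is negative, `toNat` names the term `n = 0`, which
  -- vanishes as well; this is the source of the two cutoffs.
  have hne1 (n : ℕ) (hn : n ≠ j.toNat) :
      (S ^ n) (adjointSymbol S L (i + n) (j - n) (k - n)) = 0 := by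
    rw [adjointSymbol, if_neg (by omega), map_zero]
  have hne2 (n : ℕ) (hn : n ≠ (-i - 1).toNat) :
      (S ^ n) (applyRatio S (symbolW L) (i + n) (j - n) (k - n)) = 0 := by
    rw [applyRatio, symbolW, if_neg (by omega), map_zero, map_zero]
  have h1 : ∑ᶠ n : ℕ, (S ^ n) (adjointSymbol S L (i + n) (j - n) (k - n)) =
      if k = -i then (if 0 ≤ j then 1 else 0) * (S ^ k) (L (j - k)) else 0 := by
    rw [finsum_eq_single _ _ hne1, adjointSymbol]
    by_cases hk : k = -i
    · by_cases hj : 0 ≤ j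
      · lift j to ℕ using hj
        rw [Int.toNat_natCast, if_pos (by omega), if_pos hk, if_pos (by omega), one_mul,
          ← zpow_natCast, ← zpow_add_apply, show (j : ℤ) + -(i + j) = k by omega,
          show i + (j : ℤ) = j - k by omega]
      · rw [if_neg (by omega), if_neg hj, zero_mul, map_zero, ite_self]
    · rw [if_neg (by omega), if_neg hk, map_zero]
  have h2 : ∑ᶠ n : ℕ, (S ^ n) (applyRatio S (symbolW L) (i + n) (j - n) (k - n)) =
      if k = -i then (if i + 1 ≤ 0 then 1 else 0) * (S ^ k) (L (j - k)) else 0 := by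
    rw [finsum_eq_single _ _ hne2, applyRatio, symbolW]
    by_cases hk : k = -i
    · by_cases hi : i + 1 ≤ 0
      · rw [if_pos (by omega), if_pos hk, if_pos hi, one_mul, ← zpow_natCast]
        have e := zpow_add_apply S (k - 1) 1 (L (j - k))
        rw [sub_add_cancel, zpow_one] at e
        rw [e, show ((-i - 1).toNat : ℤ) = k - 1 by omega, show j - (k - 1) - 1 = j - k by ring]
      · rw [if_neg (by omega), if_neg hi, zero_mul, map_zero, map_zero, ite_self]
    · rw [if_neg (by omega), if_neg hk, map_zero, map_zero]
  simp only [applyDeltaPlus, Pi.sub_apply, map_sub]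
  rw [finsum_sub_distrib, h1, h2]
  · split_ifs <;> simp
  · exact (Set.finite_singleton j.toNat).subset fun n hn => by_contra fun h => hn (hne1 n h)
  · exact (Set.finite_singleton (-i - 1).toNat).subset
      fun n hn => by_contra fun h => hn (hne2 n h)

/-- `δ₊(wλS/z) L(w) L^*(λ/z)`. -/
theorem applyDeltaPlus_mul_adjoint (L : ℤ → V) (i j k : ℤ) :
    applyDeltaPlus S (mulSymbolW L (adjointSymbol S L)) i j k =
      if k = -i then ∑ᶠ n : ℕ, (S ^ (n : ℤ)) (L (j - n)) * (S ^ k) (L (n - k)) else 0 := by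
  have h (i j k : ℤ) : mulSymbolW L (adjointSymbol S L) i j k =
      if k = -i then L j * (S ^ k) (L i) else 0 := by
    rw [mulSymbolW, finsum_eq_single _ j]
    · by_cases hk : k = -i <;> simp [adjointSymbol, hk]
    · intro m hm
      have : j - m ≠ 0 := by omega
      simp [adjointSymbol, this]
  simp only [applyDeltaPlus, h]
  by_cases hk : k = -i
  · simp only [hk, if_true]
    refine finsum_congr fun n => ?_
    rw [if_pos (by ring), map_mul, ← zpow_natCast, ← zpow_add_apply]
    congr 3 <;> ring_nf
  · simp only [hk, if_false]
    refine finsum_eq_zero_of_forall_eq_zero fun n => ?_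
    rw [if_neg (by omega), map_zero]

theorem SuppBounded.finite_shift_mul_shift {ε : ℤˣ} {L : ℤ → V} (hL : SuppBounded ε L)
    (j k : ℤ) : (support fun t : ℤ => (S ^ t) (L (j - t)) * (S ^ k) (L (t - k))).Finite := by
  obtain ⟨N, h⟩ := hL
  refine finite_support_int_of_bounds (-(N.natAbs + j.natAbs + k.natAbs))
    (N.natAbs + j.natAbs + k.natAbs) fun m hm => ?_
  have h1 := h _ (ne_zero_of_zpow_ne_zero S (left_ne_zero_of_mul hm))
  have h2 := h _ (ne_zero_of_zpow_ne_zero S (right_ne_zero_of_mul hm))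
  rcases Int.units_eq_one_or ε with rfl | rfl <;> simp at h1 h2 <;> omega

/-- The coefficients of the right-hand side of the 3-Adler identity. -/
theorem adlerThreeRHS_apply {ε : ℤˣ} {L : ℤ → V} (hL : SuppBounded ε L) (i j k : ℤ) :
    adlerThreeRHS S L i j k =
      (S ^ k) (L (j - k)) * (∑ᶠ q : ℤ, ((if q ≤ j then 1 else 0) - (if q < k then 1 else 0)) *
        (L q * (S ^ q) (L (i + k - q)))) -
      L (i + k) * ∑ᶠ t : ℤ, ((if 0 ≤ t then 1 else 0) - (if i + k < t then 1 else 0)) *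
        ((S ^ t) (L (j - t)) * (S ^ k) (L (t - k))) := by
  -- Both series are supported on `k = -i`, so multiplication by `L(z)` picks out the single
  -- coefficient of index `i + k`.
  have hZ (G : Series3 V) (g : ℤ → ℤ → ℤ → V) (hG : ∀ i j k, G i j k =
      if k = -i then g i j k else 0) (i j k : ℤ) :
      mulSymbolZ L G i j k = L (i + k) * g (-k) j k := by
    rw [mulSymbolZ, finsum_eq_single _ (i + k)]
    · rw [hG, if_pos (by ring)]; congr 2; ring
    · intro m hm
      rw [hG, if_neg (by omega), mul_zero]
  have h1 : applyWLS S L (mulSymbolZ L (applyDeltaPlus S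
      (adjointSymbol S L - applyRatio S (symbolW L)))) i j k =
      (S ^ k) (L (j - k)) * (∑ᶠ q : ℤ, ((if q ≤ j then 1 else 0) - (if q < k then 1 else 0)) *
        (L q * (S ^ q) (L (i + k - q)))) := by
    rw [mul_finsum', applyWLS]
    · refine finsum_congr fun m => ?_
      rw [hZ _ _ (applyDeltaPlus_adjoint_sub_ratio L), map_mul, map_mul, ← zpow_add_apply]
      have e1 : m + (k - m) = k := by ring
      have e2 : j - m - (k - m) = j - k := by ring
      have e3 : i + (k - m) = i + k - m := by ring
      have e4 : (0 ≤ j - m) = (m ≤ j) := by simp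
      have e5 : (-(k - m) + 1 ≤ 0) = (m < k) := propext (by omega)
      rw [e1, e2, e3]
      simp only [e4, e5]
      have e6 (p : Prop) [Decidable p] : (S ^ m) (if p then (1 : V) else 0) =
          if p then 1 else 0 := by split_ifs <;> simp
      rw [map_sub, e6, e6]
      ring
    · exact (hL.finite_comp (S := S) hL (i + k)).subset fun m hm => right_ne_zero_of_mul hm
  let g (t : ℤ) : V := (S ^ t) (L (j - t)) * (S ^ k) (L (t - k))
  have hg : (support g).Finite := hL.finite_shift_mul_shift j k
  have h2 : mulSymbolZ L (applyDeltaPlus S (mulSymbolW L (adjointSymbol S L))) i j k =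
      L (i + k) * ∑ᶠ t : ℤ, (if 0 ≤ t then 1 else 0) * g t := by
    rw [hZ _ _ (applyDeltaPlus_mul_adjoint L), ← finsum_nat_add_eq_finsum_int g 0]
    simp [g]
  -- Here `L(wλS)` contributes `Sⁱ⁺ᵏ` and the ratio one more `S`, so the geometric series starts at
  -- `i + k + 1` instead of `0`.
  have h3 : applyWLS S L (applyRatio S (applyDeltaPlus S (mulSymbolW L (adjointSymbol S L))))
      i j k = L (i + k) * ∑ᶠ t : ℤ, (if i + k + 1 ≤ t then 1 else 0) * g t := by
    rw [← finsum_nat_add_eq_finsum_int g, applyWLS, finsum_eq_single _ (i + k)]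
    · rw [applyRatio, applyDeltaPlus_mul_adjoint, if_pos (by ring)]
      have e : ∀ x, (S ^ (i + k)) (S x) = (S ^ (i + k + 1)) x := fun x => by
        rw [zpow_add_apply S (i + k) 1, zpow_one]
      have e' (n : ℕ) : (S ^ (i + k + 1)) ((S ^ (n : ℤ)) (L (j - (i + k) - 1 - n)) *
          (S ^ (k - (i + k) - 1)) (L (n - (k - (i + k) - 1)))) = g (n + (i + k + 1)) := by
        rw [map_mul, ← zpow_add_apply, ← zpow_add_apply]
        congr 3 <;> ring_nf
      rw [e, zpow_finsum]
      · simp only [e']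
      · refine (hg.preimage (f := fun n : ℕ => (n : ℤ) + (i + k + 1))
          fun a _ b _ h => by simpa using h).subset fun n hn => ?_
        rw [Set.mem_preimage, mem_support, ← e']
        exact (map_ne_zero_iff _ (S ^ (i + k + 1)).injective).2 hn
    · intro m hm
      rw [applyRatio, applyDeltaPlus_mul_adjoint, if_neg (by omega), map_zero, map_zero, mul_zero]
  have h4 : ∑ᶠ t : ℤ, ((if 0 ≤ t then 1 else 0) - (if i + k < t then 1 else 0)) * g t =
      (∑ᶠ t : ℤ, (if 0 ≤ t then 1 else 0) * g t) -
        ∑ᶠ t : ℤ, (if i + k + 1 ≤ t then 1 else 0) * g t := by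
    rw [← finsum_sub_distrib (hg.subset fun t ht => right_ne_zero_of_mul ht)
      (hg.subset fun t ht => right_ne_zero_of_mul ht)]
    exact finsum_congr fun t => by rw [sub_mul]; rfl
  rw [h4, mul_sub, ← h1, ← h2, ← h3]
  rfl

end PseudoDiff

/-! ### The Lax equation and involution. -/

namespace MulPVA

open PseudoDiff

variable {F V : Type*} [Field F] [CommRing V] [Algebra F V] (A : MulPVA F V)

/-- Summing over the internal degree of `L M` or `M L` reduces both halves of the Adler identity to
weighted sums of the same terms `G q t` of `L X L`; commutativity identifies the two inner products.
-/
theorem variationTrace_of_isAdlerThree {ε : ℤˣ} {L M : ℤ → V} (hL : SuppBounded ε L)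
    (hM : SuppBounded ε M) (hLM : comp A.shift L M = comp A.shift M L)
    (hA : IsAdlerThree A L) (j : ℤ) :
    A.variationTrace (L j) L M =
      -commutator A.shift (posPart (comp A.shift L (comp A.shift L M))) L j := by
  let S := A.shift
  let X := comp S L M
  have hX : SuppBounded ε X := hL.comp hM
  let G (q t : ℤ) : V := L q * (S ^ q) (X (t - q)) * (S ^ t) (L (j - t))
  have hG : (support fun x : ℤ × ℤ => G x.1 x.2).Finite := hL.finite_comp₃ hX hL j
  have hGt (w : ℤ → ℤ → V) : (support fun x : ℤ × ℤ => w x.2 x.1 * G x.2 x.1).Finite :=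
    (hG.preimage (Equiv.prodComm ℤ ℤ).injective.injOn).subset
      fun x hx => right_ne_zero_of_mul hx
  -- The step `q < t` occurs in both weights, so `w₁ - w₂` retains only `q ≤ j` and `0 ≤ t`.
  let w₁ (q t : ℤ) : V := (if q ≤ j then 1 else 0) - (if q < t then 1 else 0)
  let w₂ (q t : ℤ) : V := (if 0 ≤ t then 1 else 0) - (if q < t then 1 else 0)
  let f₁ (i k q : ℤ) : V := w₁ q k *
    (L q * (S ^ q) (L (i + k - q)) * (S ^ (k + i)) (M (-i)) * (S ^ k) (L (j - k)))
  let f₂ (i k t : ℤ) : V := w₂ (i + k) t *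
    (L (i + k) * (S ^ (k + i)) (M (-i)) * (S ^ k) (L (t - k)) * (S ^ t) (L (j - t)))
  have hf₁ : (support fun x : ℤ × ℤ × ℤ => f₁ x.1 x.2.1 x.2.2).Finite := by
    obtain ⟨N, h⟩ := hL
    obtain ⟨N', h'⟩ := hM
    -- The degrees `q`, `i + k - q`, `-i`, `j - k` of the three factors `L` and the factor `M` sum
    -- to `j`.
    let B : ℤ := 3 * N.natAbs + N'.natAbs + j.natAbs
    refine finite_support_int_prod₃_of_bounds (-B) B fun x hx => ?_
    have hx := right_ne_zero_of_mul hx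
    have h1 := h _ (left_ne_zero_of_mul (left_ne_zero_of_mul (left_ne_zero_of_mul hx)))
    have h2 := h _ (ne_zero_of_zpow_ne_zero S
      (right_ne_zero_of_mul (left_ne_zero_of_mul (left_ne_zero_of_mul hx))))
    have h3 := h' _ (ne_zero_of_zpow_ne_zero S (right_ne_zero_of_mul (left_ne_zero_of_mul hx)))
    have h4 := h _ (ne_zero_of_zpow_ne_zero S (right_ne_zero_of_mul hx))
    rcases Int.units_eq_one_or ε with rfl | rfl <;> simp at h1 h2 h3 h4 <;> omega
  have hf₂ : (support fun x : ℤ × ℤ × ℤ => f₂ x.1 x.2.1 x.2.2).Finite := by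
    obtain ⟨N, h⟩ := hL
    obtain ⟨N', h'⟩ := hM
    let B : ℤ := 3 * N.natAbs + N'.natAbs + j.natAbs
    refine finite_support_int_prod₃_of_bounds (-B) B fun x hx => ?_
    have hx := right_ne_zero_of_mul hx
    have h1 := h _ (left_ne_zero_of_mul (left_ne_zero_of_mul (left_ne_zero_of_mul hx)))
    have h2 := h' _ (ne_zero_of_zpow_ne_zero S
      (right_ne_zero_of_mul (left_ne_zero_of_mul (left_ne_zero_of_mul hx))))
    have h3 := h _ (ne_zero_of_zpow_ne_zero S (right_ne_zero_of_mul (left_ne_zero_of_mul hx)))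
    have h4 := h _ (ne_zero_of_zpow_ne_zero S (right_ne_zero_of_mul hx))
    rcases Int.units_eq_one_or ε with rfl | rfl <;> simp at h1 h2 h3 h4 <;> omega
  have hcoeff (i k : ℤ) : (A.bracket (L i) (L j)).coeff k * (S ^ k) ((S ^ i) (M (-i))) =
      (∑ᶠ q, f₁ i k q) - ∑ᶠ t, f₂ i k t := by
    have hfin₁ := hL.finite_comp (S := S) hL (i + k)
    have hfin₂ := hL.finite_shift_mul_shift (S := S) j k
    rw [hA, adlerThreeRHS_apply hL, ← zpow_add_apply, sub_mul, mul_right_comm,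
      mul_right_comm (L (i + k)), mul_finsum' _ _ (hfin₁.subset fun q hq =>
        right_ne_zero_of_mul hq), mul_finsum' _ _ (hfin₂.subset fun t ht =>
        right_ne_zero_of_mul ht)]
    congr 1 <;> refine finsum_congr fun t => ?_
    · simp only [f₁, w₁, S]; ring
    · simp only [f₂, w₂, S]; ring
  have hT₁ : ∑ᶠ i, ∑ᶠ k, ∑ᶠ q, f₁ i k q = ∑ᶠ t, ∑ᶠ q, w₁ q t * G q t := by
    rw [finsum_rotate_of_finite hf₁]
    refine finsum_congr fun t => finsum_congr fun q => ?_
    have h := comp_apply_shift (S := S) hL hM (w₁ q t * L q * (S ^ t) (L (j - t))) q t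
    rw [← finsum_comp_equiv (Equiv.addRight t)] at h
    refine Eq.trans (finsum_congr fun i => ?_) (h.symm.trans ?_)
    · simp only [f₁, Equiv.coe_addRight]
      rw [add_comm t i, show t - (i + t) = -i by ring]
      ring
    · simp only [G, X]; ring
  have hf₂' : (support fun x : ℤ × ℤ × ℤ => f₂ (x.2.2 - x.1) x.1 x.2.1).Finite := by
    let e : ℤ × ℤ × ℤ ≃ ℤ × ℤ × ℤ :=
      ⟨fun x => (x.2.2 - x.1, x.1, x.2.1), fun x => (x.2.1, x.2.2, x.1 + x.2.1),
        fun x => by simp, fun x => by simp⟩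
    exact hf₂.preimage e.injective.injOn
  have hT₂ : ∑ᶠ i, ∑ᶠ k, ∑ᶠ t, f₂ i k t = ∑ᶠ t, ∑ᶠ q, w₂ q t * G q t := by
    calc ∑ᶠ i, ∑ᶠ k, ∑ᶠ t, f₂ i k t = ∑ᶠ k, ∑ᶠ t, ∑ᶠ i, f₂ i k t :=
          finsum_rotate_of_finite hf₂
      _ = ∑ᶠ k, ∑ᶠ t, ∑ᶠ q, f₂ (q - k) k t :=
          finsum_congr fun k => finsum_congr fun t =>
            (finsum_comp_equiv (Equiv.subRight k) (f := fun i => f₂ i k t)).symm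
      _ = ∑ᶠ t, ∑ᶠ q, ∑ᶠ k, f₂ (q - k) k t :=
          finsum_rotate_of_finite (f := fun k t q => f₂ (q - k) k t) hf₂'
      _ = _ := by
          refine finsum_congr fun t => finsum_congr fun q => ?_
          have h := comp_apply_shift (S := S) hM hL (w₂ q t * L q * (S ^ t) (L (j - t))) q t
          refine Eq.trans (finsum_congr fun k => ?_) (h.symm.trans ?_)
          · simp only [f₂]
            rw [sub_add_cancel, add_sub_cancel, neg_sub]
            ring
          · simp only [G, X, hLM, S]; ring
  have hP₁ : comp S (posPart (comp S L X)) L j =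
      ∑ᶠ t, ∑ᶠ q, (if 0 ≤ t then 1 else 0) * G q t := by
    refine finsum_congr fun t => ?_
    by_cases ht : 0 ≤ t
    · simp only [PseudoDiff.posPart, if_pos ht, one_mul]
      exact comp_apply_mul hL hX t _
    · simp [PseudoDiff.posPart, if_neg ht]
  have hP₂ : comp S L (posPart (comp S L X)) j =
      ∑ᶠ t, ∑ᶠ q, (if q ≤ j then 1 else 0) * G q t := by
    rw [finsum_comm_of_finite (hGt fun q _ => if q ≤ j then 1 else 0)]
    refine finsum_congr fun q => ?_
    by_cases hq : q ≤ j
    · have h : comp S L X = comp S X L := by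
        simp only [X]
        rw [comp_assoc hL hM hL, ← hLM]
      simp only [PseudoDiff.posPart, sub_nonneg, if_pos hq, one_mul, h]
      exact comp_apply_shift hX hL _ q j
    · simp [PseudoDiff.posPart, hq]
  calc A.variationTrace (L j) L M
      = ∑ᶠ i, ∑ᶠ k, ((∑ᶠ q, f₁ i k q) - ∑ᶠ t, f₂ i k t) :=
        finsum_congr fun i => finsum_congr fun k => hcoeff i k
    _ = ∑ᶠ t, ∑ᶠ q, (w₁ q t * G q t - w₂ q t * G q t) := by
        rw [finsum_sub_distrib₃ hf₁ hf₂, hT₁, hT₂,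
          finsum_sub_distrib₂ (f := fun t q => w₁ q t * G q t) (hGt w₁) (hGt w₂)]
    _ = ∑ᶠ t, ∑ᶠ q, ((if q ≤ j then 1 else 0) * G q t - (if 0 ≤ t then 1 else 0) * G q t) :=
        finsum_congr fun t => finsum_congr fun q => by simp only [w₁, w₂]; ring
    _ = comp S L (posPart (comp S L X)) j - comp S (posPart (comp S L X)) L j := by
        rw [finsum_sub_distrib₂ (f := fun t q => (if q ≤ j then 1 else 0) * G q t)
          (hGt fun q _ => if q ≤ j then 1 else 0) (hGt fun _ t => if 0 ≤ t then 1 else 0),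
          hP₁, hP₂]
    _ = _ := by rw [PseudoDiff.commutator, Pi.sub_apply, neg_sub]

/-- The Lax equation `{∫hₙ, L} = [(Lⁿ⁺¹)₊, L]`. -/
theorem timeDeriv_hamDensity [CharZero F] {ε : ℤˣ} {L : ℤ → V} (hL : SuppBounded ε L)
    (hA : IsAdlerThree A L) (n : ℕ) :
    (fun j => A.timeDeriv (A.integral (hamDensity A.shift L (n + 1))) (L j)) =
      commutator A.shift (posPart (pow A.shift L (n + 2))) L := by
  have hcomm : comp A.shift L (pow A.shift L n) = comp A.shift (pow A.shift L n) L := by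
    simpa [pow, comp_one] using (pow_comp_pow (S := A.shift) hL n 1).symm
  ext j
  have h := A.variationTrace_of_isAdlerThree hL (hL.pow n) hcomm hA j
  have hn : ((n + 1 : ℕ) : F) ≠ 0 := Nat.cast_ne_zero.2 n.succ_ne_zero
  change A.bracketAtOne (hamDensity A.shift L (n + 1)) (L j) = _
  rw [hamDensity, if_neg n.succ_ne_zero, map_neg, map_smul, LinearMap.neg_apply,
    LinearMap.smul_apply, bracketAtOne_mres_pow A hL, h, ← Nat.cast_smul_eq_nsmul F, smul_smul,
    one_div_mul_cancel hn, one_smul, neg_neg]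
  -- By definition of the powers, `L ∘ (L ∘ Lⁿ)` is `Lⁿ⁺²`.
  rfl

/-- The flow of `∫hₘ` sends `mres Lⁿ` to the residue of a commutator, which `∫` kills. -/
theorem functionalBracket_hamDensity [CharZero F] {ε : ℤˣ} {L : ℤ → V} (hL : SuppBounded ε L)
    (hA : IsAdlerThree A L) (m n : ℕ) :
    A.functionalBracket (A.integral (hamDensity A.shift L m))
      (A.integral (hamDensity A.shift L n)) = 0 := by
  rw [functionalBracket_integral]
  change A.integral (A.bracketAtOne _ _) = 0
  rcases m with _ | m
  · simp [hamDensity]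
  rcases n with _ | n
  · simp [hamDensity]
  have hD := map_pow_of_leibniz (A.bracketAtOne_mul_right (hamDensity A.shift L (m + 1)))
    (A.bracketAtOne_shift_right _) hL (hL.pow (m + 2)).posPart (A.timeDeriv_hamDensity hL hA m)
    (n + 1)
  have hW (y : V) : A.shift y - y ∈ A.totalDifferences := ⟨y, rfl⟩
  have hmem := mres_commutator_mem hW (hL.pow (S := A.shift) (m + 2)).posPart
    (hL.pow (S := A.shift) (n + 1))
  rw [← hD] at hmem
  refine (Submodule.Quotient.mk_eq_zero _).2 ?_
  nth_rw 2 [hamDensity]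
  rw [if_neg n.succ_ne_zero, map_neg, map_smul]
  exact neg_mem (Submodule.smul_mem _ _ hmem)

end MulPVA

end

theorem mainTheorem2 {F V : Type*} [Field F] [CharZero F] [CommRing V] [Algebra F V]
    (A : MulPVA F V) (L : ℤ → V) (hL : PseudoDiff.IsPseudoDiff L)
    (hAdler : PseudoDiff.IsAdlerThree A L)
    (h : ℕ → A.Functional)
    (hh : ∀ n : ℕ, h n = A.integral (PseudoDiff.hamDensity A.shift L n)) :
    (∀ m n : ℕ, A.functionalBracket (h m) (h n) = 0) ∧
    (∀ m n : ℕ, A.Compatible (h m) (h n)) ∧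
    (∀ n : ℕ, 1 ≤ n →
      (fun j : ℤ => A.timeDeriv (h n) (L j)) =
        PseudoDiff.commutator A.shift
          (PseudoDiff.posPart (PseudoDiff.pow A.shift L (n + 1))) L) ∧
    (∀ m n : ℕ, A.IsIntegralOfMotion (h n) (h m)) := by
  obtain ⟨ε, hε⟩ := hL.exists_suppBounded
  have hzero (m n : ℕ) : A.functionalBracket (h m) (h n) = 0 := by
    rw [hh, hh]
    exact A.functionalBracket_hamDensity hε hAdler m n
  refine ⟨hzero, fun m n => A.compatible_of_functionalBracket_eq_zero (hzero m n), ?_,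
    fun m n => hzero n m⟩
  rintro (_ | n) hn
  · exact absurd hn (by norm_num)
  · rw [hh]
    exact A.timeDeriv_hamDensity hε hAdler n
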